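/- Let $q,k\in\mathbb{N}$, let $\mathcal X=\{1,\dots,q\}$ and $\mathcal Y=\{1,\dots,k\}$, and let $P_{Y|X}$ be a channel from $\mathcal X$ to $\mathcal Y$ (a $q\times k$ stochastic matrix) that is strictly positive, i.e. $P_{Y|X}(j|i)>0$ for all $i,j$. For $n\ge 1$, an $n$-type is a probability distribution $P$ on $\mathcal X$ all of whose values are integer multiples of $1/n$; $T_n(P)\subseteq\mathcal X^n$ denotes the set of sequences in which each symbol $a$ occurs exactly $nP(a)$ times; $U$ is uniform on $T_n(P)$; and $P_{Y|X}^n\circ U$ is the law of the sequence $Y^n$ obtained by drawing $X^n\sim U$ and passing each coordinate of $X^n$ independently through $P_{Y|X}$. Let $P_Y(j)=\sum_i P(i)P_{Y|X}(j|i)$, let $Q_Y^n$ be the $n$-fold product of a distribution $Q_Y$ on $\mathcal Y$, and let $D(\cdot\|\cdot)\in[0,\infty]$ be the Kullback–Leibler divergence (natural logarithm, with $0\cdot\infty=0$). There exists a constant $c=c(P_{Y|X})\in[0,\infty)$ such that $$n\,D(P_Y\|Q_Y)\;\le\; D(P_{Y|X}^n\circ U\,\|\,Q_Y^n)\;\le\;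 n\,D(P_Y\|Q_Y)+c\qquad(\ast)$$ for all $n\ge1$, all $n$-types $P$ and all distributions $Q_Y$ on $\mathcal Y$. Moreover, for every constant $c\in[0,\infty)$ with which $(\ast)$ holds for all such $n$, $P$, $Q_Y$, the following is true: for all $n\ge 1$, all $n$-types $P$, all distributions $Q_Y$ on $\mathcal Y$ and all integers $0\le m\le n$, if $Y^n\sim P_{Y|X}^n\circ U$ and $P_{Y^m}$ denotes the law of the first $m$ coordinates of $Y^n$, then $$D(P_{Y^m}\|Q_Y^m)\;\le\; m\,D(P_Y\|Q_Y)+\frac{m}{n}\,c .$$ -/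

import Mathlib

open MeasureTheory ProbabilityTheory InformationTheory
open scoped ENNReal NNReal

namespace NoisyPermutation

/-- The `n`-types: probability distributions all of whose values are of the form `j / n`. -/
def IsNType {α : Type*} (n : ℕ) (P : PMF α) : Prop :=
  ∀ a, ∃ j : ℕ, P a = (j : ℝ≥0∞) / (n : ℝ≥0∞)

/-- The type class `T_n(P)`: the sequences of length `n` in which every symbol `a` occurs with
relative frequency exactly `P a`. -/
def typeClass {α : Type*} [DecidableEq α] (n : ℕ) (P : PMF α) : Set (Fin n → α) :=
  {x | ∀ a, ((Finset.univ.filter (fun t => x t = a)).card : ℝ≥0∞) / (n : ℝ≥0∞) = P a}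

/-- A channel (a stochastic matrix, `W i j` being the probability that the input symbol `i`
becomes the output symbol `j`) is strictly positive if all its entries are positive. -/
def StrictlyPositive {q k : ℕ} (W : Fin q → PMF (Fin k)) : Prop :=
  ∀ i j, 0 < W i j

/-- The memoryless extension `P_{Y|X}^n` of the channel: given the input sequence `x`, the output
symbols are independent, the `t`-th one having law `W (x t)`. -/
noncomputable def channelPow {q k : ℕ} (W : Fin q → PMF (Fin k)) (n : ℕ) (x : Fin n → Fin q) :
    Measure (Fin n → Fin k) :=
  Measure.pi (fun t => (W (x t)).toMeasure)

/-- The law `P_{Y|X}^n ∘ U` of the output sequence `Y^n` when the input sequence is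
uniformly distributed on the type class `T_n(P)`. -/
noncomputable def outputLaw {q k : ℕ} (W : Fin q → PMF (Fin k)) (n : ℕ) (P : PMF (Fin q)) :
    Measure (Fin n → Fin k) :=
  (uniformOn (typeClass n P)).bind (channelPow W n)

/-- The marginal distribution `P_Y` of `Y` when `(X, Y)` has law `P × P_{Y|X}`. -/
noncomputable def outputMarginal {q k : ℕ} (W : Fin q → PMF (Fin k)) (P : PMF (Fin q)) :
    Measure (Fin k) :=
  (P.bind W).toMeasure

/-- The product distribution `Q^n`. -/
noncomputable def iidLaw {k : ℕ} (Q : PMF (Fin k)) (n : ℕ) : Measure (Fin n → Fin k) :=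
  Measure.pi (fun _ => Q.toMeasure)

/-- The law of the first `m` coordinates of a random vector with law `μ`. -/
noncomputable def firstCoords {k n m : ℕ} (hm : m ≤ n) (μ : Measure (Fin n → Fin k)) :
    Measure (Fin m → Fin k) :=
  μ.map (fun y t => y (Fin.castLE hm t))

/-- `c` is an admissible constant for the channel `W`: for every length `n`, every `n`-type `P`
and every distribution `Q_Y`,
`n D(P_Y ‖ Q_Y) ≤ D(P_{Y|X}^n ∘ U ‖ Q_Y^n) ≤ n D(P_Y ‖ Q_Y) + c`. -/
def IsTypeConstant {q k : ℕ} (W : Fin q → PMF (Fin k)) (c : ℝ≥0) : Prop :=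
  ∀ n : ℕ, 0 < n → ∀ P : PMF (Fin q), IsNType n P → ∀ Q : PMF (Fin k),
    (n : ℝ≥0∞) * klDiv (outputMarginal W P) Q.toMeasure ≤
        klDiv (outputLaw W n P) (iidLaw Q n) ∧
      klDiv (outputLaw W n P) (iidLaw Q n) ≤
        (n : ℝ≥0∞) * klDiv (outputMarginal W P) Q.toMeasure + (c : ℝ≥0∞)

end NoisyPermutation

/-! The core is a domination: the mass function of `P_{Y|X}^n ∘ U` is at most `C` times that of
`P_Y^n`, with `C` independent of `n` and `P` (`StrictlyPositive.exists_outputLaw_le`). All sequences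
of a type have the same probability under `P^n`, so the output law is the law of `Y^n` for i.i.d.
pairs, conditioned on `X^n` having type `P`. By Bayes, the ratio of its mass at `y` to `P_Y^n(y)` is
the probability that `X^n` has type `P` given `Y^n = y`, divided by the unconditional probability.
Given `y`, the `X_t` are independent, and each posterior is at least `ρ P`, where `ρ` is a positive
lower bound for the entries of the channel. So each posterior is a mixture with weight `ρ` on `P`.
If `N` coordinates draw from `P`, then conditionally on the others their count vector must hit one
prescribed value. By Stirling this has probability at most a constant times `((n+1)/(N+1))^q` times
the unconditional probability of the type. Since `N` is binomial with parameter `ρ`, that factor has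
bounded mean (`exists_sum_prod_le`).

As every coordinate of the output has law `P_Y`, the divergence from `Q^n` is `n D(P_Y‖Q)` plus the
divergence from `P_Y^n`. The latter lies between `0` and `log C`, which gives the two-sided bound.

For initial segments, exchangeability makes `m ↦ H(Y^m)` concave, so `H(Y^m) ≥ (m/n) H(Y^n)` (Han).
The cross terms are linear in `m`, and the bound with `Q_Y = P_Y` controls the excess at `m = n`. -/

namespace NoisyPermutation

/-! ### Stirling bounds, squared to avoid square roots. -/

/-- `n ! ≤ e √n (n / e) ^ n`, squared. -/
theorem factorial_sq_le {n : ℕ} (hn : 0 < n) :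
    ((n.factorial : ℝ)) ^ 2 ≤ Real.exp 2 * n * ((n : ℝ) ^ (2 * n) * Real.exp (-(2 * n))) := by
  obtain ⟨m, rfl⟩ := Nat.exists_eq_succ_of_ne_zero hn.ne'
  have h := Stirling.stirlingSeq'_antitone (Nat.zero_le m)
  simp only [Function.comp, Nat.succ_eq_add_one, zero_add, Stirling.stirlingSeq_one] at h
  rw [Stirling.stirlingSeq, div_le_iff₀ (by positivity)] at h
  have h2 := pow_le_pow_left₀ (by positivity) h 2
  refine h2.trans (le_of_eq ?_)
  rw [mul_pow, mul_pow, div_pow, Real.sq_sqrt (by positivity), Real.sq_sqrt (by positivity),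
    ← pow_mul, div_pow, ← Real.exp_nat_mul, ← Real.exp_nat_mul, Real.exp_neg]
  have : Real.exp (((m + 1) * 2 : ℕ) * 1) = Real.exp (2 * ((m + 1 : ℕ) : ℝ)) := by
    congr 1; push_cast; ring
  rw [this]
  have h3 : Real.exp ((2 : ℕ) * 1) = Real.exp 2 := by norm_num
  rw [h3, Nat.succ_eq_add_one, mul_comm (m + 1) 2]
  field_simp

/-- `√(2 π n) (n / e) ^ n ≤ n !`, squared. -/
theorem le_factorial_sq (n : ℕ) :
    2 * Real.pi * n * ((n : ℝ) ^ (2 * n) * Real.exp (-(2 * n))) ≤ (n.factorial : ℝ) ^ 2 := by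
  have h := pow_le_pow_left₀ (by positivity) (Stirling.le_factorial_stirling n) 2
  refine (le_of_eq ?_).trans h
  rw [mul_pow, Real.sq_sqrt (by positivity), ← pow_mul, div_pow, ← Real.exp_nat_mul, Real.exp_neg]
  have : Real.exp ((n * 2 : ℕ) * 1) = Real.exp (2 * (n : ℝ)) := by
    congr 1; push_cast; ring
  rw [this, mul_comm n 2]
  field_simp

/-- The Poisson mass function of parameter `l` is at most `1 / √l`, squared. -/
theorem pow_mul_exp_le_factorial_sq {l : ℝ} (hl : 0 ≤ l) (s : ℕ) :
    l ^ (2 * s + 1) * Real.exp (-(2 * l)) ≤ (s.factorial : ℝ) ^ 2 := by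
  -- The left side, as a function of `l`, is largest at `l = s + 1/2`; `1 + x ≤ exp x` proves it
  -- without calculus.
  have hx : (0 : ℝ) < s + 1 / 2 := by positivity
  have h1 : l ^ (2 * s + 1) * Real.exp (-(2 * l)) ≤
      (s + 1 / 2 : ℝ) ^ (2 * s + 1) * Real.exp (-(2 * s + 1)) := by
    have h2 : l ≤ (s + 1 / 2) * Real.exp (l / (s + 1 / 2) - 1) := by
      have := Real.add_one_le_exp (l / (s + 1 / 2) - 1)
      rw [sub_add_cancel, div_le_iff₀ hx] at this
      linarith
    calc l ^ (2 * s + 1) * Real.exp (-(2 * l))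
        ≤ ((s + 1 / 2) * Real.exp (l / (s + 1 / 2) - 1)) ^ (2 * s + 1) * Real.exp (-(2 * l)) := by
          gcongr
      _ = _ := by
          rw [mul_pow, ← Real.exp_nat_mul, mul_assoc, ← Real.exp_add]
          congr 2
          push_cast
          field_simp
          ring
  refine h1.trans ?_
  -- `s = 0` is separate because the lower Stirling bound degenerates to `0` there.
  rcases Nat.eq_zero_or_pos s with rfl | hs
  · simp only [CharP.cast_eq_zero, Nat.factorial]
    have : Real.exp (-1) ≤ 1 := Real.exp_le_one_iff.2 (by norm_num)
    norm_num
    linarith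
  refine le_trans ?_ (le_factorial_sq s)
  have hs' : (1 : ℝ) ≤ s := by exact_mod_cast hs
  have h3 : (s + 1 / 2 : ℝ) ≤ s * Real.exp (1 / (2 * s)) := by
    have := Real.add_one_le_exp (1 / (2 * s : ℝ))
    calc (s + 1 / 2 : ℝ) = s * (1 / (2 * s) + 1) := by field_simp; ring
      _ ≤ _ := by gcongr
  calc (s + 1 / 2 : ℝ) ^ (2 * s + 1) * Real.exp (-(2 * s + 1))
      ≤ (s * Real.exp (1 / (2 * s))) ^ (2 * s + 1) * Real.exp (-(2 * s + 1)) := by gcongr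
    _ = s * s ^ (2 * s) * Real.exp (1 / (2 * s) - 2 * s) := by
        rw [mul_pow, ← Real.exp_nat_mul, mul_assoc, ← Real.exp_add, pow_succ,
          mul_comm ((s : ℝ) ^ (2 * s))]
        congr 2
        push_cast
        field_simp
        ring
    _ ≤ s * s ^ (2 * s) * (2 * Real.pi * Real.exp (-(2 * s))) := by
        gcongr
        rw [sub_eq_add_neg, Real.exp_add]
        gcongr
        have h4 : Real.exp (1 / (2 * s)) ≤ Real.exp 1 := by
          gcongr
          rw [div_le_one (by positivity)]; linarith
        have := Real.exp_one_lt_d9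
        have := Real.pi_gt_three
        linarith
    _ = _ := by ring

/-! ### Multinomial masses and their size at the mean. -/

/-- The probability that `∑ a, s a` independent variables of law `p` have `s` as count vector. -/
noncomputable def multinomialMass {α : Type*} [Fintype α] (p : α → ℝ) (s : α → ℕ) : ℝ :=
  ((∑ a, s a).factorial : ℝ) * ∏ a, (p a ^ s a / ((s a).factorial : ℝ))

section

variable {α : Type*} [Fintype α]

theorem multinomialMass_nonneg {p : α → ℝ} (hp : ∀ a, 0 ≤ p a) (s : α → ℕ) :
    0 ≤ multinomialMass p s := by
  unfold multinomialMass
  have : ∀ a, 0 ≤ p a ^ s a / ((s a).factorial : ℝ) := fun a => by have := hp a; positivity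
  exact mul_nonneg (by positivity) (Finset.prod_nonneg fun a _ => this a)

theorem multinomial_mul_prod_pow (p : α → ℝ) (s : α → ℕ) :
    (Nat.multinomial Finset.univ s : ℝ) * ∏ a, p a ^ s a = multinomialMass p s := by
  have h := Nat.multinomial_spec Finset.univ s
  have h' : (∏ a, ((s a).factorial : ℝ)) * (Nat.multinomial Finset.univ s : ℝ)
      = ((∑ a, s a).factorial : ℝ) := by exact_mod_cast h
  have h0 : (∏ a, ((s a).factorial : ℝ)) ≠ 0 :=
    Finset.prod_ne_zero_iff.2 fun a _ => by positivity
  rw [multinomialMass, ← h', Finset.prod_div_distrib]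
  field_simp

theorem multinomialMass_sq (p : α → ℝ) (s : α → ℕ) :
    multinomialMass p s ^ 2 = ((∑ a, s a).factorial : ℝ) ^ 2 *
      ∏ a, (p a ^ (2 * s a) / ((s a).factorial : ℝ) ^ 2) := by
  rw [multinomialMass, mul_pow, ← Finset.prod_pow]
  simp only [div_pow, ← pow_mul, mul_comm]

-- Each factor is bounded by the Poisson estimate with parameter `N * p a`; since `p` sums to one,
-- the exponentials cancel against those of `N !`. Symbols with `p a = 0` either kill the mass or do
-- not occur.
open Finset in
theorem multinomialMass_sq_le {p : α → ℝ} (hp : ∀ a, 0 ≤ p a) (hp1 : ∑ a, p a = 1) (s : α → ℕ)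
    (hs : 0 < ∑ a, s a) :
    multinomialMass p s ^ 2 ≤ Real.exp 2 * (∑ a, s a : ℕ) /
      ∏ a with p a ≠ 0, ((∑ a, s a : ℕ) * p a) := by
  classical
  set N : ℕ := ∑ a, s a with hN
  have hN0 : (0 : ℝ) < N := by exact_mod_cast hs
  have hD : (0 : ℝ) < ∏ a with p a ≠ 0, (N * p a) := by
    refine prod_pos fun a ha => ?_
    have : 0 < p a := lt_of_le_of_ne (hp a) (Ne.symm (mem_filter.1 ha).2)
    positivity
  by_cases hz : ∃ a, p a = 0 ∧ s a ≠ 0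
  · obtain ⟨a, ha, hsa⟩ := hz
    have : multinomialMass p s = 0 := by
      rw [multinomialMass, prod_eq_zero (mem_univ a), mul_zero]
      simp [ha, hsa]
    rw [this, zero_pow two_ne_zero]
    exact div_nonneg (by positivity) hD.le
  push Not at hz
  have hsum : ∑ a with p a ≠ 0, s a = N := by
    rw [hN, sum_filter_of_ne]
    intro a _ h1 h2
    exact h1 (hz a h2)
  have hsump : ∑ a with p a ≠ 0, p a = 1 := by
    rw [sum_filter_ne_zero, hp1]
  rw [multinomialMass_sq, ← hN]
  have hfac : ∏ a, (p a ^ (2 * s a) / ((s a).factorial : ℝ) ^ 2) =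
      ∏ a with p a ≠ 0, (p a ^ (2 * s a) / ((s a).factorial : ℝ) ^ 2) := by
    rw [prod_filter_of_ne]
    intro a _ h1 h2
    apply h1
    simp [hz a h2]
  have hle : ∏ a with p a ≠ 0, (p a ^ (2 * s a) / ((s a).factorial : ℝ) ^ 2) ≤
      ∏ a with p a ≠ 0, (Real.exp (2 * N * p a) * ((N : ℝ) ^ (2 * s a))⁻¹ * (N * p a)⁻¹) := by
    refine prod_le_prod (fun a _ => ?_) fun a ha => ?_
    · have := hp a
      positivity
    have hpa : 0 < p a := lt_of_le_of_ne (hp a) (Ne.symm (mem_filter.1 ha).2)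
    have h := pow_mul_exp_le_factorial_sq (l := N * p a) (by positivity) (s a)
    rw [div_le_iff₀ (by positivity)]
    refine le_trans (le_of_eq ?_) (mul_le_mul_of_nonneg_left h (by positivity))
    rw [pow_succ, mul_pow, Real.exp_neg, ← mul_assoc 2]
    field_simp
  rw [hfac]
  refine (mul_le_mul (factorial_sq_le hs) hle (prod_nonneg fun a _ => ?_) (by positivity)).trans
    (le_of_eq ?_)
  · have := hp a
    positivity
  rw [prod_mul_distrib, prod_mul_distrib, ← Real.exp_sum, ← mul_sum, hsump, prod_inv_distrib,
    prod_inv_distrib, prod_pow_eq_pow_sum, ← mul_sum, hsum, Real.exp_neg]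
  field_simp

-- At the mean, `s a = N * p a`, so Stirling matches the upper bound for general `s` up to a factor
-- `exp (-2)` for each symbol of the support.
open Finset in
theorem le_multinomialMass_sq {p : α → ℝ} (hp : ∀ a, 0 ≤ p a) (hp1 : ∑ a, p a = 1) (s : α → ℕ)
    (hs : 0 < ∑ a, s a) (hps : ∀ a, (s a : ℝ) = (∑ a, s a : ℕ) * p a) :
    Real.exp (-(2 * Fintype.card α)) * (∑ a, s a : ℕ) /
      ∏ a with p a ≠ 0, ((∑ a, s a : ℕ) * p a) ≤ multinomialMass p s ^ 2 := by
  classical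
  set N : ℕ := ∑ a, s a with hN
  have hN0 : (0 : ℝ) < N := by exact_mod_cast hs
  have hz : ∀ a, p a = 0 → s a = 0 := by
    intro a ha
    have := hps a
    rw [ha, mul_zero] at this
    exact_mod_cast this
  have hsum : ∑ a with p a ≠ 0, s a = N := by
    rw [hN, sum_filter_of_ne]
    intro a _ h1 h2
    exact h1 (hz a h2)
  have hsump : ∑ a with p a ≠ 0, p a = 1 := by
    rw [sum_filter_ne_zero, hp1]
  rw [multinomialMass_sq, ← hN]
  have hfac : ∏ a, (p a ^ (2 * s a) / ((s a).factorial : ℝ) ^ 2) =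
      ∏ a with p a ≠ 0, (p a ^ (2 * s a) / ((s a).factorial : ℝ) ^ 2) := by
    rw [prod_filter_of_ne]
    intro a _ h1 h2
    apply h1
    simp [hz a h2]
  have hle : ∏ a with p a ≠ 0, (Real.exp (-2) * (Real.exp (2 * N * p a) *
      ((N : ℝ) ^ (2 * s a))⁻¹ * (N * p a)⁻¹)) ≤
      ∏ a with p a ≠ 0, (p a ^ (2 * s a) / ((s a).factorial : ℝ) ^ 2) := by
    have hpa : ∀ a ∈ univ.filter (fun a => p a ≠ 0), 0 < p a := fun a ha =>
      lt_of_le_of_ne (hp a) (Ne.symm (mem_filter.1 ha).2)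
    refine prod_le_prod (fun a ha => ?_) fun a ha => ?_
    · have := hpa a ha
      positivity
    have hpa := hpa a ha
    have hsa : 0 < s a := by
      have : (0 : ℝ) < s a := by rw [hps a]; positivity
      exact_mod_cast this
    have h := factorial_sq_le hsa
    rw [le_div_iff₀ (by positivity)]
    refine le_trans (mul_le_mul_of_nonneg_left h (by positivity)) (le_of_eq ?_)
    rw [hps a, mul_pow, Real.exp_neg, Real.exp_neg, ← mul_assoc 2]
    field_simp
  have hcard : Real.exp (-(2 * Fintype.card α)) ≤ ∏ a with p a ≠ 0, Real.exp (-2) := by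
    rw [prod_const, ← Real.exp_nat_mul]
    gcongr
    have : (#{a | p a ≠ 0} : ℝ) ≤ Fintype.card α := by exact_mod_cast card_le_univ _
    linarith
  have hDpos : 0 < ∏ a with p a ≠ 0, (N * p a) := prod_pos fun a ha => by
    have := lt_of_le_of_ne (hp a) (Ne.symm (mem_filter.1 ha).2)
    positivity
  have hprod : ∏ a with p a ≠ 0, (Real.exp (-2) * (Real.exp (2 * N * p a) *
      ((N : ℝ) ^ (2 * s a))⁻¹ * (N * p a)⁻¹)) = (∏ a with p a ≠ 0, Real.exp (-2)) *
      (Real.exp (2 * N) * ((N : ℝ) ^ (2 * N))⁻¹ * (∏ a with p a ≠ 0, (N * p a))⁻¹) := by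
    rw [prod_mul_distrib]
    congr 1
    rw [prod_mul_distrib, prod_mul_distrib, ← Real.exp_sum, ← mul_sum, hsump,
      prod_inv_distrib, prod_inv_distrib, prod_pow_eq_pow_sum, ← mul_sum, hsum, mul_one]
  rw [hfac]
  refine le_trans ?_ (mul_le_mul (le_factorial_sq N) hle (prod_nonneg fun a _ => ?_)
    (by positivity))
  swap
  · have := hp a
    positivity
  rw [hprod, Real.exp_neg (2 * (N : ℝ))]
  calc Real.exp (-(2 * Fintype.card α)) * N / ∏ a with p a ≠ 0, (N * p a)
      ≤ (∏ a with p a ≠ 0, Real.exp (-2)) * (2 * Real.pi * N) / ∏ a with p a ≠ 0, (N * p a) := by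
        gcongr
        have := Real.pi_gt_three
        nlinarith
    _ = _ := by
        field_simp

open Finset in
/-- The mass function of a multinomial distribution of sample size `∑ a, s a`, compared with the
mass at its mean of the one with the same `p` and sample size `∑ a, d a`. -/
theorem multinomialMass_le {p : α → ℝ} (hp : ∀ a, 0 ≤ p a) (hp1 : ∑ a, p a = 1) (d s : α → ℕ)
    (hd : 0 < ∑ a, d a) (hpd : ∀ a, (d a : ℝ) = (∑ a, d a : ℕ) * p a)
    (hsd : ∑ a, s a ≤ ∑ a, d a) :
    multinomialMass p s ≤ Real.exp (1 + Fintype.card α) *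
      (2 * (((∑ a, d a : ℕ) + 1) / ((∑ a, s a : ℕ) + 1))) ^ Fintype.card α *
        multinomialMass p d := by
  classical
  set q := Fintype.card α
  have hlow := le_multinomialMass_sq hp hp1 d hd hpd
  have hup := multinomialMass_sq_le hp hp1 s
  have hd0 := multinomialMass_nonneg hp d
  set n : ℕ := ∑ a, d a with hn
  set N : ℕ := ∑ a, s a with hN
  refine le_of_sq_le_sq ?_ (by positivity)
  have hpos : ∀ a ∈ univ.filter (fun a => p a ≠ 0), 0 < p a := fun a ha =>
    lt_of_le_of_ne (hp a) (Ne.symm (mem_filter.1 ha).2)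
  set r := #{a | p a ≠ 0} with hr
  have hrq : r ≤ q := card_le_univ _
  have hr1 : 0 < r := by
    rw [hr, card_pos]
    by_contra h
    rw [not_nonempty_iff_eq_empty] at h
    rw [← sum_filter_ne_zero, h] at hp1
    simp at hp1
  set P := ∏ a with p a ≠ 0, p a with hP
  have hP0 : 0 < P := prod_pos hpos
  have hP1 : P ≤ 1 := prod_le_one (fun a _ => hp a) fun a _ => by
    rw [← hp1]; exact single_le_sum (fun a _ => hp a) (mem_univ a)
  have hnP : ∏ a with p a ≠ 0, (n * p a) = (n : ℝ) ^ r * P := by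
    rw [prod_mul_distrib, prod_const]
  rw [hnP] at hlow
  have hn0 : (0 : ℝ) < n := by exact_mod_cast hd
  have hx1 : (1 : ℝ) ≤ 2 * ((n + 1) / (N + 1)) := by
    have : (N : ℝ) ≤ n := by exact_mod_cast hsd
    rw [← mul_div_assoc, one_le_div (by positivity)]
    linarith
  set x : ℝ := 2 * ((n + 1) / (N + 1)) with hx
  rw [mul_pow, mul_pow, ← Real.exp_nat_mul, ← pow_mul]
  refine le_trans ?_ (mul_le_mul_of_nonneg_left hlow (by positivity))
  have hexp : Real.exp ((2 : ℕ) * (1 + q)) * x ^ (q * 2) *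
      (Real.exp (-(2 * q)) * n / (n ^ r * P)) =
      Real.exp 2 * x ^ (q * 2) * (n / (n ^ r * P)) := by
    have : Real.exp ((2 : ℕ) * (1 + q)) * Real.exp (-(2 * q)) = Real.exp 2 := by
      rw [← Real.exp_add]; congr 1; push_cast; ring
    rw [← this]; ring
  rw [hexp]
  clear_value r
  -- With `t + 1` the size of the support, both squared bounds are multiples of `1 / (M ^ t * P)`,
  -- where `M` is the sample size. Their ratio is governed by `(n / N) ^ t`, and `t ≤ 2 * q` leaves
  -- room.
  obtain ⟨t, rfl⟩ : ∃ t, r = t + 1 := ⟨r - 1, by omega⟩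
  have hred : ∀ M : ℝ, 0 < M → M / (M ^ (t + 1) * P) = 1 / (M ^ t * P) := fun M hM => by
    rw [pow_succ]; field_simp
  -- An empty sample has mass `1`; the `N + 1` in the denominator of `x` keeps the bound meaningful
  -- here.
  rcases Nat.eq_zero_or_pos N with h0 | hpN
  · have hs0 : ∀ a, s a = 0 := fun a => (sum_eq_zero_iff.1 (hN ▸ h0)) a (mem_univ a)
    have h1 : multinomialMass p s = 1 := by
      simp [multinomialMass, hs0]
    rw [h1, hred n hn0, one_pow, mul_one_div, one_le_div (by positivity)]
    have hnx : (n : ℝ) ≤ x := by rw [hx, h0]; simp; linarith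
    calc (n : ℝ) ^ t * P ≤ x ^ t * 1 := by gcongr
      _ ≤ 1 * x ^ (q * 2) := by
        rw [mul_one, one_mul]; exact pow_le_pow_right₀ hx1 (by omega)
      _ ≤ _ := by gcongr; exact Real.one_le_exp (by norm_num)
  · have hN0 : (0 : ℝ) < N := by exact_mod_cast hpN
    have hNP : ∏ a with p a ≠ 0, (N * p a) = (N : ℝ) ^ (t + 1) * P := by
      rw [prod_mul_distrib, prod_const, ← hr]
    refine (hup hpN).trans ?_
    rw [hNP, mul_div_assoc, mul_assoc, hred n hn0, hred N hN0]
    gcongr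
    rw [mul_one_div, div_le_div_iff₀ (by positivity) (by positivity), one_mul, ← mul_assoc]
    gcongr
    calc (n : ℝ) ^ t ≤ (x * N) ^ t := by
          gcongr
          rw [hx, ← mul_div_assoc, div_mul_eq_mul_div, le_div_iff₀ (by positivity)]
          have : (1 : ℝ) ≤ N := by exact_mod_cast hpN
          nlinarith
      _ = x ^ t * N ^ t := mul_pow _ _ _
      _ ≤ x ^ (q * 2) * N ^ t := by
        exact mul_le_mul_of_nonneg_right (pow_le_pow_right₀ hx1 (by omega)) (by positivity)

end

/-! ### Inverse moments of the binomial distribution. -/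

section BinomialMoment

open Finset

/-- One factor `(n+1)/(N+1)` is absorbed by `choose n N`, which becomes `choose (n+1) (N+1)`. This
lowers the exponent by one and moves to sample size `n + 1`, at the cost of `1/ρ`; re-centring the
other factors costs `2 ^ q`. -/
theorem exists_binomial_moment_le {ρ : ℝ} (h0 : 0 < ρ) (h1 : ρ ≤ 1) (q : ℕ) :
    ∃ C : ℝ, 0 ≤ C ∧ ∀ n : ℕ, ∑ N ∈ range (n + 1), (n.choose N : ℝ) *
      (ρ ^ N * (1 - ρ) ^ (n - N) * (((n : ℝ) + 1) / (N + 1)) ^ q) ≤ C := by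
  have h1' : 0 ≤ 1 - ρ := by linarith
  induction q with
  | zero =>
    refine ⟨1, zero_le_one, fun n => le_of_eq ?_⟩
    have := add_pow ρ (1 - ρ) n
    rw [add_sub_cancel, one_pow] at this
    exact (sum_congr rfl fun N _ => by rw [pow_zero]; ring).trans this.symm
  | succ q ih =>
    obtain ⟨C, hC, h⟩ := ih
    refine ⟨2 ^ q / ρ * C, by positivity, fun n => ?_⟩
    refine le_trans ?_ (mul_le_mul_of_nonneg_left (h (n + 1)) (by positivity))
    rw [sum_range_succ' _ (n + 1), mul_add, mul_sum]
    refine le_add_of_le_of_nonneg (sum_le_sum fun N _ => ?_) (by positivity)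
    have hch : (n.choose N : ℝ) * (n + 1) / (N + 1) = (n + 1).choose (N + 1) := by
      rw [div_eq_iff (by positivity), mul_comm]
      exact_mod_cast Nat.add_one_mul_choose_eq n N
    have hle : ((n : ℝ) + 1) / (N + 1) ≤ 2 * (((n + 1 : ℕ) + 1) / ((N + 1 : ℕ) + 1)) := by
      push_cast
      rw [← mul_div_assoc, div_le_div_iff₀ (by positivity) (by positivity)]
      have : (0 : ℝ) ≤ n := by positivity
      have : (0 : ℝ) ≤ N := by positivity
      nlinarith [mul_nonneg (Nat.cast_nonneg (α := ℝ) n) (Nat.cast_nonneg (α := ℝ) N)]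
    calc (n.choose N : ℝ) * (ρ ^ N * (1 - ρ) ^ (n - N) * (((n : ℝ) + 1) / (N + 1)) ^ (q + 1))
        = (n + 1).choose (N + 1) * (ρ ^ N * (1 - ρ) ^ (n - N) * (((n : ℝ) + 1) / (N + 1)) ^ q) := by
          rw [← hch, pow_succ]; ring
      _ ≤ (n + 1).choose (N + 1) * (ρ ^ N * (1 - ρ) ^ (n - N) *
          (2 * (((n + 1 : ℕ) + 1) / ((N + 1 : ℕ) + 1))) ^ q) := by gcongr
      _ = _ := by
          rw [Nat.add_sub_add_right, mul_pow, pow_succ ρ]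
          field_simp

end BinomialMoment

/-! ### Generating polynomials of count vectors. -/

section Coefficients

open MvPolynomial Finset

variable {α : Type*}

/-- Convolution does not raise the maximal mass: the value of `g` at the all-ones point is its total
mass. -/
theorem coeff_mul_le_mul_eval [Fintype α] {f g : MvPolynomial α ℝ} {M : ℝ}
    (hf : ∀ s, MvPolynomial.coeff s f ≤ M) (hM : 0 ≤ M) (hg : ∀ s, 0 ≤ MvPolynomial.coeff s g)
    (d : α →₀ ℕ) : MvPolynomial.coeff d (f * g) ≤ M * MvPolynomial.eval (fun _ => 1) g := by
  classical
  rw [MvPolynomial.coeff_mul]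
  calc ∑ x ∈ antidiagonal d, MvPolynomial.coeff x.1 f * MvPolynomial.coeff x.2 g
      ≤ ∑ x ∈ antidiagonal d, M * MvPolynomial.coeff x.2 g :=
        sum_le_sum fun x _ => mul_le_mul_of_nonneg_right (hf _) (hg _)
    _ = M * ∑ s ∈ (antidiagonal d).image Prod.snd, MvPolynomial.coeff s g := by
        rw [← mul_sum, sum_image]
        intro x hx y hy hxy
        rw [mem_coe, HasAntidiagonal.mem_antidiagonal] at hx hy
        exact Prod.ext (add_right_cancel (hx.trans (hxy ▸ hy.symm))) hxy
    _ ≤ M * ∑ s ∈ g.support, MvPolynomial.coeff s g := by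
        refine mul_le_mul_of_nonneg_left ?_ hM
        refine (sum_le_sum_of_subset_of_nonneg (subset_union_left (s₂ := g.support))
          fun s _ _ => hg s).trans (le_of_eq ?_)
        exact (sum_subset subset_union_right fun s _ hs => MvPolynomial.notMem_support_iff.1 hs).symm
    _ = _ := by
        rw [MvPolynomial.eval_eq']
        simp

theorem coeff_prod_nonneg {ι : Type*} (B : Finset ι) (f : ι → MvPolynomial α ℝ)
    (h : ∀ i ∈ B, ∀ s, 0 ≤ MvPolynomial.coeff s (f i)) (s : α →₀ ℕ) :
    0 ≤ MvPolynomial.coeff s (∏ i ∈ B, f i) := by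
  classical
  revert s
  refine Finset.prod_induction f (fun g => ∀ s, 0 ≤ MvPolynomial.coeff s g) ?_ ?_ h
  · intro a b ha hb s
    rw [MvPolynomial.coeff_mul]
    exact sum_nonneg fun x _ => mul_nonneg (ha _) (hb _)
  · intro s
    rw [MvPolynomial.coeff_one]
    split_ifs <;> simp

/-- The linear form with coefficients `v`. -/
noncomputable def linearForm [Fintype α] (v : α → ℝ) : MvPolynomial α ℝ := ∑ a, v a • X a

theorem coeff_linearForm_nonneg [Fintype α] {v : α → ℝ} (hv : ∀ a, 0 ≤ v a) (s : α →₀ ℕ) :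
    0 ≤ MvPolynomial.coeff s (linearForm v) := by
  classical
  rw [linearForm, MvPolynomial.coeff_sum]
  refine sum_nonneg fun a _ => ?_
  rw [MvPolynomial.coeff_smul, MvPolynomial.coeff_X, smul_eq_mul]
  have := hv a
  split_ifs <;> simp [this]

theorem eval_linearForm [Fintype α] (v : α → ℝ) :
    MvPolynomial.eval (fun _ => 1) (linearForm v) = ∑ a, v a := by
  simp [linearForm, MvPolynomial.smul_eval]

theorem coeff_linearForm_pow [Fintype α] (p : α → ℝ) (s : α →₀ ℕ) (n : ℕ) :
    MvPolynomial.coeff s (linearForm p ^ n) =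
      if ∑ a, s a = n then multinomialMass p s else 0 := by
  classical
  rw [linearForm, MvPolynomial.coeff_linearCombination_X_pow_of_fintype,
    Finsupp.sum_fintype _ _ (by simp)]
  split_ifs with h
  · rw [← multinomial_mul_prod_pow, Finsupp.prod_fintype _ _ (by simp),
      Finsupp.multinomial_eq_of_support_subset (subset_univ _)]
  · rfl

/-- The number of occurrences of each symbol in a finite family. -/
noncomputable def countVec {ι : Type*} [Fintype ι] (x : ι → α) : α →₀ ℕ :=
  ∑ t, Finsupp.single (x t) 1

/-- The product of linear forms is the generating function of the count vector of independent
symbols. -/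
theorem coeff_prod_linearForm [Fintype α] [DecidableEq α] {ι : Type*} [Fintype ι] [DecidableEq ι]
    (v : ι → α → ℝ) (d : α →₀ ℕ) :
    MvPolynomial.coeff d (∏ t, linearForm (v t)) =
      ∑ x : ι → α with countVec x = d, ∏ t, v t (x t) := by
  simp only [linearForm]
  rw [Finset.prod_univ_sum, Fintype.piFinset_univ, MvPolynomial.coeff_sum, sum_filter]
  refine sum_congr rfl fun x _ => ?_
  have : ∏ t, v t (x t) • (X (x t) : MvPolynomial α ℝ) =
      monomial (countVec x) (∏ t, v t (x t)) := by
    rw [countVec, MvPolynomial.monomial_sum_prod]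
    refine prod_congr rfl fun t _ => ?_
    rw [X, MvPolynomial.smul_monomial, smul_eq_mul, mul_one]
  rw [this, MvPolynomial.coeff_monomial]

theorem sum_prod_eq_multinomialMass [Fintype α] [DecidableEq α] {n : ℕ} (p : α → ℝ) {d : α →₀ ℕ}
    (hd : ∑ a, d a = n) :
    ∑ x : Fin n → α with countVec x = d, ∏ t, p (x t) = multinomialMass p d := by
  rw [← coeff_prod_linearForm (fun _ => p), prod_const, card_univ, Fintype.card_fin,
    coeff_linearForm_pow, if_pos hd]

theorem linearForm_mul [Fintype α] (c : ℝ) (v : α → ℝ) :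
    linearForm (fun a => c * v a) = MvPolynomial.C c * linearForm v := by
  rw [linearForm, linearForm, mul_sum]
  exact sum_congr rfl fun a _ => by rw [MvPolynomial.smul_eq_C_mul, MvPolynomial.smul_eq_C_mul,
    map_mul, mul_assoc]

theorem linearForm_add [Fintype α] (v w : α → ℝ) :
    linearForm (fun a => v a + w a) = linearForm v + linearForm w := by
  simp [linearForm, add_smul, sum_add_distrib]

/-- If independent symbols have laws proportional to `v t`, each of them bounded below by `ρ` times
`p`, then the probability that their count vector is the mean count vector of `p` is at most a
constant times what it is for symbols of law `p`. -/
theorem exists_sum_prod_le (α : Type*) [Fintype α] [DecidableEq α] {ρ : ℝ} (h0 : 0 < ρ)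
    (h1 : ρ ≤ 1) :
    ∃ C : ℝ, 0 ≤ C ∧ ∀ (n : ℕ) (p : α → ℝ) (d : α →₀ ℕ) (v : Fin n → α → ℝ) (c : Fin n → ℝ),
      0 < n → (∀ a, 0 ≤ p a) → ∑ a, p a = 1 → ∑ a, d a = n → (∀ a, (d a : ℝ) = n * p a) →
      (∀ t, 0 ≤ c t) → (∀ t, ∑ a, v t a = c t) → (∀ t a, ρ * c t * p a ≤ v t a) →
      ∑ x : Fin n → α with countVec x = d, ∏ t, v t (x t) ≤
        C * multinomialMass p d * ∏ t, c t := by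
  obtain ⟨C, hC, hmom⟩ := exists_binomial_moment_le h0 h1 (Fintype.card α)
  set q := Fintype.card α with hq
  refine ⟨Real.exp (1 + q) * 2 ^ q * C, by positivity, ?_⟩
  intro n p d v c hn hp hp1 hd hdp hc hvc hv
  have h1' : 0 ≤ 1 - ρ := by linarith
  have hm0 := multinomialMass_nonneg hp d
  have hc0 : 0 ≤ ∏ t, c t := prod_nonneg fun t _ => hc t
  rw [← coeff_prod_linearForm]
  -- The mixture decomposition; the remainder has nonnegative coefficients and total mass `(1 - ρ) *
  -- c t`.
  have hsplit : ∀ t, linearForm (v t) = MvPolynomial.C (ρ * c t) * linearForm p +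
      linearForm (fun a => v t a - ρ * c t * p a) := fun t => by
    rw [← linearForm_mul, ← linearForm_add]
    simp
  simp_rw [hsplit]
  rw [Fintype.prod_add, MvPolynomial.coeff_sum]
  -- `B` is the set of coordinates that draw from `p`; summed over `B`, the weights form a binomial
  -- law of `#B`.
  have hterm : ∀ B : Finset (Fin n), MvPolynomial.coeff d
      ((∏ t ∈ B, (MvPolynomial.C (ρ * c t) * linearForm p)) *
        ∏ t ∈ Bᶜ, linearForm (fun a => v t a - ρ * c t * p a)) ≤
      (Real.exp (1 + q) * 2 ^ q * multinomialMass p d * ∏ t, c t) *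
        (ρ ^ #B * (1 - ρ) ^ (n - #B) * (((n : ℝ) + 1) / (#B + 1)) ^ q) := by
    intro B
    have hBn : #B ≤ n := by simpa using card_le_univ B
    rw [prod_mul_distrib, prod_const, ← map_prod, mul_assoc, MvPolynomial.coeff_C_mul]
    have hM : ∀ s, MvPolynomial.coeff s (linearForm p ^ #B) ≤
        Real.exp (1 + q) * (2 * (((n : ℝ) + 1) / (#B + 1))) ^ q * multinomialMass p d := by
      intro s
      rw [coeff_linearForm_pow]
      split_ifs with hs
      · have := multinomialMass_le hp hp1 d s (by omega) (by rwa [hd]) (by omega)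
        rwa [hd, hs] at this
      · positivity
    have hle := coeff_mul_le_mul_eval hM (by positivity)
      (coeff_prod_nonneg Bᶜ (fun t => linearForm (fun a => v t a - ρ * c t * p a))
        fun t _ => coeff_linearForm_nonneg fun a => sub_nonneg.2 (hv t a)) d
    have hev : MvPolynomial.eval (fun _ => 1)
        (∏ t ∈ Bᶜ, linearForm (fun a => v t a - ρ * c t * p a)) =
        (1 - ρ) ^ (n - #B) * ∏ t ∈ Bᶜ, c t := by
      have hcard : #Bᶜ = n - #B := by simp [card_compl]
      rw [map_prod, ← hcard, ← prod_const, ← prod_mul_distrib]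
      refine prod_congr rfl fun t _ => ?_
      rw [eval_linearForm, sum_sub_distrib, hvc, ← mul_sum, hp1]
      ring
    rw [hev] at hle
    refine (mul_le_mul_of_nonneg_left hle
      (prod_nonneg fun t _ => mul_nonneg h0.le (hc t))).trans (le_of_eq ?_)
    rw [prod_mul_distrib, prod_const, ← prod_mul_prod_compl B c, mul_pow 2]
    ring
  refine (sum_le_sum fun B _ => hterm B).trans ?_
  rw [← mul_sum, ← powerset_univ, sum_powerset_apply_card
    (fun N => ρ ^ N * (1 - ρ) ^ (n - N) * (((n : ℝ) + 1) / (N + 1)) ^ q), card_univ,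
    Fintype.card_fin]
  simp_rw [nsmul_eq_mul]
  refine (mul_le_mul_of_nonneg_left (hmom n) (by positivity)).trans (le_of_eq ?_)
  ring

end Coefficients

/-! ### Entropy of exchangeable sequences. -/

section Entropy

open Finset

/-- Submodularity of the entropy for a symmetric joint law of two variables. -/
theorem two_mul_sum_mul_log_le {β : Type*} [Fintype β] (h : β → β → ℝ) (h0 : ∀ b c, 0 ≤ h b c)
    (hsymm : ∀ b c, h b c = h c b) :
    2 * ∑ b, (∑ c, h b c) * Real.log (∑ c, h b c) ≤
      ∑ b, ∑ c, h b c * Real.log (h b c) +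
        (∑ b, ∑ c, h b c) * Real.log (∑ b, ∑ c, h b c) := by
  set r : β → ℝ := fun b => ∑ c, h b c with hr
  set S : ℝ := ∑ b, r b with hS
  have hr0 : ∀ b, 0 ≤ r b := fun b => sum_nonneg fun c _ => h0 b c
  have hS0 : 0 ≤ S := sum_nonneg fun b _ => hr0 b
  -- Nonnegativity of mutual information, termwise from `log x ≤ x - 1` at `x = r b * r c / (h b c *
  -- S)`; the left sides sum to zero.
  have hle : ∀ b c, h b c - r b * r c / S ≤
      h b c * Real.log (h b c) + h b c * Real.log S - h b c * Real.log (r b) -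
        h b c * Real.log (r c) := by
    intro b c
    rcases (h0 b c).eq_or_lt with hz | hpos
    · rw [← hz]
      have : 0 ≤ r b * r c / S := div_nonneg (mul_nonneg (hr0 b) (hr0 c)) hS0
      simp only [zero_mul]
      linarith
    have hb : 0 < r b := hpos.trans_le (single_le_sum (fun c _ => h0 b c) (mem_univ c))
    have hc : 0 < r c := hpos.trans_le
      ((hsymm b c).le.trans (single_le_sum (fun b _ => h0 c b) (mem_univ b)))
    have hSp : 0 < S := hb.trans_le (single_le_sum (fun b _ => hr0 b) (mem_univ b))
    have hlog := Real.log_le_sub_one_of_pos (x := r b * r c / (h b c * S)) (by positivity)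
    rw [Real.log_div (by positivity) (by positivity), Real.log_mul hb.ne' hc.ne',
      Real.log_mul hpos.ne' hSp.ne'] at hlog
    have := mul_le_mul_of_nonneg_left hlog hpos.le
    have he : h b c * (r b * r c / (h b c * S) - 1) = r b * r c / S - h b c := by
      field_simp
    rw [he] at this
    linarith
  have hsum := sum_le_sum fun b (_ : b ∈ univ) => sum_le_sum fun c (_ : c ∈ univ) => hle b c
  simp only [sum_sub_distrib, sum_add_distrib, ← sum_mul, ← mul_sum, ← sum_div] at hsum
  have hcol : ∑ b, ∑ c, h b c * Real.log (r c) = ∑ b, r b * Real.log (r b) := by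
    rw [sum_comm]
    refine sum_congr rfl fun c _ => ?_
    rw [← sum_mul]
    congr 1
    exact sum_congr rfl fun b _ => hsymm b c
  rw [hcol] at hsum
  have hSS : S * S / S = S := mul_self_div_self S
  simp only [← hr, ← hS] at hsum ⊢
  rw [hSS] at hsum
  have hrr : ∀ b, ∑ c, h b c = r b := fun _ => rfl
  simp only [hrr] at hsum
  linarith

/-- Convexity and `F 0 = 0` make `F m / m` nondecreasing. -/
theorem mul_le_mul_of_convex_seq {F : ℕ → ℝ} {n : ℕ} (h0 : F 0 = 0)
    (h : ∀ m, m + 2 ≤ n → 2 * F (m + 1) ≤ F (m + 2) + F m) {m : ℕ} (hm : m ≤ n) :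
    n * F m ≤ m * F n := by
  have hstep : ∀ m, m + 1 ≤ n → (m + 1 : ℝ) * F m ≤ m * F (m + 1) := by
    intro m
    induction m with
    | zero => intro _; simp [h0]
    | succ m ih =>
      intro hm
      have h1 := ih (by omega)
      have h2 := mul_le_mul_of_nonneg_left (h m hm) (by positivity : (0 : ℝ) ≤ m + 1)
      push_cast
      nlinarith
  have key : ∀ j, m ≤ j → j ≤ n → (j : ℝ) * F m ≤ m * F j := by
    intro j hj
    induction j, hj using Nat.le_induction with
    | base => intro _; exact le_rfl
    | succ j hj ih =>
      intro hjn
      rcases Nat.eq_zero_or_pos j with rfl | hpos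
      · obtain rfl : m = 0 := by omega
        simp [h0]
      have h1 := ih (by omega)
      have h2 := hstep j hjn
      have hj0 : (0 : ℝ) < j := by exact_mod_cast hpos
      have hm0 : (0 : ℝ) ≤ m := by positivity
      refine le_of_mul_le_mul_left ?_ hj0
      push_cast
      calc (j : ℝ) * ((j + 1) * F m) = (j + 1) * (j * F m) := by ring
        _ ≤ (j + 1) * (m * F j) := by gcongr
        _ = m * ((j + 1) * F j) := by ring
        _ ≤ m * (j * F (j + 1)) := by gcongr
        _ = _ := by ring
  exact key n hm le_rfl

theorem restrict_eq_snoc_iff {β : Type*} {n m : ℕ} (hm : m + 1 ≤ n) (y : Fin n → β) (u : Fin m → β)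
    (c : β) :
    (fun t => y (Fin.castLE hm t)) = (Fin.snoc u c : Fin (m + 1) → β) ↔
      (fun t => y (Fin.castLE (Nat.le_of_succ_le hm) t)) = u ∧ y ⟨m, hm⟩ = c := by
  rw [funext_iff, funext_iff, Fin.forall_fin_succ']
  simp only [Fin.snoc_castSucc, Fin.snoc_last]
  rfl

theorem sum_snoc {β : Type*} [Fintype β] {m : ℕ} (G : (Fin (m + 1) → β) → ℝ) :
    ∑ w, G w = ∑ u : Fin m → β, ∑ c, G (Fin.snoc u c) := by
  rw [← (Fin.snocEquiv fun _ => β).sum_comp, Fintype.sum_prod_type, sum_comm]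
  rfl

variable {κ : Type*} [Fintype κ] [DecidableEq κ] {n : ℕ}

/-- The marginal on the first `m` coordinates of a mass function. -/
def marginal {m : ℕ} (hm : m ≤ n) (f : (Fin n → κ) → ℝ) (u : Fin m → κ) : ℝ :=
  ∑ y : Fin n → κ with (fun t => y (Fin.castLE hm t)) = u, f y

theorem marginal_nonneg {m : ℕ} (hm : m ≤ n) {f : (Fin n → κ) → ℝ} (hf : ∀ y, 0 ≤ f y)
    (u : Fin m → κ) : 0 ≤ marginal hm f u :=
  sum_nonneg fun y _ => hf y

theorem sum_marginal_mul {m : ℕ} (hm : m ≤ n) (f : (Fin n → κ) → ℝ) (G : (Fin m → κ) → ℝ) :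
    ∑ u, marginal hm f u * G u = ∑ y, f y * G (fun t => y (Fin.castLE hm t)) := by
  rw [← sum_fiberwise univ (fun (y : Fin n → κ) (t : Fin m) => y (Fin.castLE hm t))]
  refine sum_congr rfl fun u _ => ?_
  rw [marginal, sum_mul]
  refine sum_congr rfl fun y hy => ?_
  rw [(mem_filter.1 hy).2]

theorem marginal_self (f : (Fin n → κ) → ℝ) (u : Fin n → κ) : marginal le_rfl f u = f u := by
  simp [marginal, filter_eq']

theorem sum_marginal_snoc {m : ℕ} (hm : m + 1 ≤ n) (f : (Fin n → κ) → ℝ) (u : Fin m → κ) :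
    ∑ c, marginal hm f (Fin.snoc u c) = marginal (Nat.le_of_succ_le hm) f u := by
  simp only [marginal, restrict_eq_snoc_iff hm]
  rw [← sum_fiberwise _ (fun y : Fin n → κ => y ⟨m, hm⟩)]
  simp only [filter_filter]

/-- The transposition of positions `m` and `m + 1` fixes the prefix and preserves `f`. -/
theorem marginal_snoc_comm {m : ℕ} (hm : m + 2 ≤ n) {f : (Fin n → κ) → ℝ}
    (hf : ∀ (σ : Equiv.Perm (Fin n)) y, f (y ∘ σ) = f y) (u : Fin m → κ) (b c : κ) :
    marginal hm f (Fin.snoc (Fin.snoc u b : Fin (m + 1) → κ) c) =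
      marginal hm f (Fin.snoc (Fin.snoc u c : Fin (m + 1) → κ) b) := by
  simp only [marginal, restrict_eq_snoc_iff]
  set σ : Equiv.Perm (Fin n) := Equiv.swap ⟨m, by omega⟩ ⟨m + 1, by omega⟩ with hσ
  have hfix : ∀ t : Fin m, σ (Fin.castLE (by omega) t) = Fin.castLE (by omega) t := fun t =>
    Equiv.swap_apply_of_ne_of_ne (by simp [Fin.ext_iff]; omega) (by simp [Fin.ext_iff]; omega)
  have hl : σ ⟨m, by omega⟩ = ⟨m + 1, by omega⟩ := Equiv.swap_apply_left _ _
  have hr : σ ⟨m + 1, by omega⟩ = ⟨m, by omega⟩ := Equiv.swap_apply_right _ _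
  refine sum_equiv (σ.arrowCongr (Equiv.refl κ)) (fun y => ?_) fun y _ => ?_
  · have hs : σ.symm = σ := Equiv.symm_swap _ _
    simp only [mem_filter, mem_univ, true_and, Equiv.arrowCongr_apply, Function.comp, hs,
      Equiv.coe_refl, id, hfix, hl, hr]
    tauto
  · exact (hf σ.symm y).symm

/-- Minus the entropy of a mass function. -/
noncomputable def negEntropy {ι : Type*} [Fintype ι] (f : ι → ℝ) : ℝ := ∑ u, f u * Real.log (f u)

/-- The entropies of the initial segments of an exchangeable sequence form a concave sequence. -/
theorem negEntropy_marginal_convex {f : (Fin n → κ) → ℝ} (h0 : ∀ y, 0 ≤ f y)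
    (hf : ∀ (σ : Equiv.Perm (Fin n)) y, f (y ∘ σ) = f y) {m : ℕ} (hm : m + 2 ≤ n) :
    2 * negEntropy (marginal (by omega : m + 1 ≤ n) f) ≤
      negEntropy (marginal hm f) + negEntropy (marginal (by omega : m ≤ n) f) := by
  simp only [negEntropy]
  rw [sum_snoc, sum_snoc, sum_snoc, ← sum_add_distrib, mul_sum]
  refine sum_le_sum fun u _ => ?_
  have := two_mul_sum_mul_log_le
    (fun b c => marginal hm f (Fin.snoc (Fin.snoc u b : Fin (m + 1) → κ) c))
    (fun b c => marginal_nonneg hm h0 _) (marginal_snoc_comm hm hf u)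
  simpa only [sum_marginal_snoc] using this

/-- **Han's inequality** for exchangeable sequences. -/
theorem mul_negEntropy_marginal_le {f : (Fin n → κ) → ℝ} (h0 : ∀ y, 0 ≤ f y) (h1 : ∑ y, f y = 1)
    (hf : ∀ (σ : Equiv.Perm (Fin n)) y, f (y ∘ σ) = f y) {m : ℕ} (hm : m ≤ n) :
    n * negEntropy (marginal hm f) ≤ m * negEntropy f := by
  have key := mul_le_mul_of_convex_seq (n := n) (m := m)
    (F := fun m => if h : m ≤ n then negEntropy (marginal h f) else 0) ?_ ?_ hm
  · simp only [hm, le_refl, dif_pos] at key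
    rwa [show marginal le_rfl f = f from funext (marginal_self f)] at key
  -- Normalisation enters here: the empty segment carries mass `1`, hence entropy `0`.
  · have : ∀ u : Fin 0 → κ, marginal (Nat.zero_le n) f u = 1 := fun u => by
      rw [marginal, ← h1]
      exact sum_congr (filter_true_of_mem fun y _ => Subsingleton.elim _ _) fun _ _ => rfl
    simp [negEntropy, this]
  · intro m hm
    simp only [hm, (by omega : m + 1 ≤ n), (by omega : m ≤ n), dif_pos]
    exact negEntropy_marginal_convex h0 hf hm

end Entropy

/-! ### Divergence on a finite space as a sum. -/

section FiniteDivergence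

open Finset

variable {Ω : Type*} [Fintype Ω] [MeasurableSpace Ω] [MeasurableSingletonClass Ω]
  {μ ν : Measure Ω} [IsProbabilityMeasure μ] [IsProbabilityMeasure ν]

theorem integral_llr_eq_sum (h : μ ≪ ν) :
    ∫ x, llr μ ν x ∂μ = ∑ x, μ.real {x} * (Real.log (μ.real {x}) - Real.log (ν.real {x})) := by
  rw [integral_fintype Integrable.of_finite]
  refine sum_congr rfl fun x _ => ?_
  rw [smul_eq_mul]
  rcases eq_or_ne (μ.real {x}) 0 with h0 | h0
  · rw [h0, zero_mul, zero_mul]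
  have hx : μ {x} = μ.rnDeriv ν x * ν {x} := by
    conv_lhs => rw [← Measure.withDensity_rnDeriv_eq μ ν h]
    rw [withDensity_apply _ (measurableSet_singleton x), lintegral_singleton]
  have hx' : μ.real {x} = (μ.rnDeriv ν x).toReal * ν.real {x} := by
    rw [measureReal_def, hx, ENNReal.toReal_mul, measureReal_def]
  have hd : (μ.rnDeriv ν x).toReal ≠ 0 := fun h => h0 (by rw [hx', h, zero_mul])
  have hν : ν.real {x} ≠ 0 := fun h => h0 (by rw [hx', h, mul_zero])
  rw [llr, hx', Real.log_mul hd hν, add_sub_cancel_right]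

theorem klDiv_eq_sum (h : μ ≪ ν) :
    klDiv μ ν = ENNReal.ofReal
      (∑ x, μ.real {x} * (Real.log (μ.real {x}) - Real.log (ν.real {x}))) := by
  rw [klDiv_of_ac_of_integrable h Integrable.of_finite, integral_llr_eq_sum h]
  simp

theorem sum_mul_log_sub_log_nonneg (h : μ ≪ ν) :
    0 ≤ ∑ x, μ.real {x} * (Real.log (μ.real {x}) - Real.log (ν.real {x})) := by
  rw [← integral_llr_eq_sum h]
  simpa using integral_llr_add_sub_measure_univ_nonneg h Integrable.of_finite

omit [Fintype Ω] [MeasurableSingletonClass Ω] [IsProbabilityMeasure μ] [IsProbabilityMeasure ν] in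
theorem absolutelyContinuous_of_singleton [Countable Ω] (h : ∀ x, ν {x} = 0 → μ {x} = 0) :
    μ ≪ ν := by
  intro s hs
  rw [← Set.biUnion_of_singleton s, measure_biUnion_null_iff s.to_countable] at hs ⊢
  exact fun x hx => h x (hs x hx)

end FiniteDivergence

/-! ### Divergence from product laws under given marginals. -/

section Product

open Finset

variable {k n : ℕ}

instance (Q : PMF (Fin k)) (m : ℕ) : IsProbabilityMeasure (iidLaw Q m) := by
  unfold iidLaw; infer_instance

theorem isProbabilityMeasure_firstCoords {m : ℕ} (hm : m ≤ n) (μ : Measure (Fin n → Fin k))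
    [IsProbabilityMeasure μ] : IsProbabilityMeasure (firstCoords hm μ) :=
  Measure.isProbabilityMeasure_map (measurable_of_finite _).aemeasurable

theorem iidLaw_real_singleton (Q : PMF (Fin k)) (m : ℕ) (u : Fin m → Fin k) :
    (iidLaw Q m).real {u} = ∏ t, (Q (u t)).toReal := by
  rw [measureReal_def, iidLaw, Measure.pi_singleton, ENNReal.toReal_prod]
  refine prod_congr rfl fun t _ => ?_
  rw [PMF.toMeasure_apply_singleton _ _ (measurableSet_singleton _)]

theorem firstCoords_real_singleton {m : ℕ} (hm : m ≤ n) (μ : Measure (Fin n → Fin k))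
    [IsProbabilityMeasure μ] (u : Fin m → Fin k) :
    (firstCoords hm μ).real {u} = marginal hm (fun y => μ.real {y}) u := by
  rw [firstCoords, map_measureReal_apply (measurable_of_finite _) (measurableSet_singleton _),
    marginal, sum_measureReal_singleton]
  congr 1
  ext y
  simp

theorem firstCoords_self (μ : Measure (Fin n → Fin k)) : firstCoords le_rfl μ = μ :=
  Measure.map_id

/-- Every coordinate of a random vector with law `μ` has law `R`. -/
def HasMarginals (μ : Measure (Fin n → Fin k)) (R : PMF (Fin k)) : Prop :=
  ∀ t j, ∑ y : Fin n → Fin k with y t = j, μ.real {y} = (R j).toReal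

theorem HasMarginals.sum_coord {μ : Measure (Fin n → Fin k)} {R : PMF (Fin k)}
    (h : HasMarginals μ R) (t : Fin n) (g : Fin k → ℝ) :
    ∑ y, μ.real {y} * g (y t) = ∑ j, (R j).toReal * g j := by
  rw [← sum_fiberwise univ (fun y : Fin n → Fin k => y t)]
  refine sum_congr rfl fun j _ => ?_
  rw [← h t j, sum_mul]
  refine sum_congr rfl fun y hy => ?_
  rw [(mem_filter.1 hy).2]

theorem HasMarginals.real_singleton_eq_zero {μ : Measure (Fin n → Fin k)} {R : PMF (Fin k)}
    (h : HasMarginals μ R) {y : Fin n → Fin k} {t : Fin n} (ht : (R (y t)).toReal = 0) :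
    μ.real {y} = 0 := by
  have hs := h t (y t)
  rw [ht, sum_eq_zero_iff_of_nonneg fun _ _ => measureReal_nonneg] at hs
  exact hs y (by simp)

theorem toMeasure_absolutelyContinuous_iff (R Q : PMF (Fin k)) :
    R.toMeasure ≪ Q.toMeasure ↔ ∀ j, (Q j).toReal = 0 → (R j).toReal = 0 := by
  have hz : ∀ (P : PMF (Fin k)) j, (P j).toReal = 0 ↔ P.toMeasure {j} = 0 := fun P j => by
    rw [PMF.toMeasure_apply_singleton _ _ (measurableSet_singleton _), ENNReal.toReal_eq_zero_iff,
      or_iff_left (P.apply_ne_top j)]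
  simp only [hz]
  exact ⟨fun h j hj => h hj, absolutelyContinuous_of_singleton⟩

/-- The cross term `∑ R log Q` of the divergence of `R` from `Q`. -/
noncomputable def crossTerm (R Q : PMF (Fin k)) : ℝ := ∑ j, (R j).toReal * Real.log (Q j).toReal

theorem klDiv_toMeasure {R Q : PMF (Fin k)} (hRQ : R.toMeasure ≪ Q.toMeasure) :
    klDiv R.toMeasure Q.toMeasure = ENNReal.ofReal (crossTerm R R - crossTerm R Q) ∧
      0 ≤ crossTerm R R - crossTerm R Q := by
  have he : crossTerm R R - crossTerm R Q = ∑ x, R.toMeasure.real {x} *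
      (Real.log (R.toMeasure.real {x}) - Real.log (Q.toMeasure.real {x})) := by
    simp only [crossTerm, ← sum_sub_distrib, ← mul_sub, measureReal_def,
      PMF.toMeasure_apply_singleton _ _ (measurableSet_singleton _)]
  rw [he]
  exact ⟨klDiv_eq_sum hRQ, sum_mul_log_sub_log_nonneg hRQ⟩

variable {μ : Measure (Fin n → Fin k)} [IsProbabilityMeasure μ] {R : PMF (Fin k)}

theorem HasMarginals.firstCoords_absolutelyContinuous (h : HasMarginals μ R) {Q : PMF (Fin k)}
    (hRQ : R.toMeasure ≪ Q.toMeasure) {m : ℕ} (hm : m ≤ n) :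
    firstCoords hm μ ≪ iidLaw Q m := by
  have := isProbabilityMeasure_firstCoords hm μ
  refine absolutelyContinuous_of_singleton fun u hu => ?_
  rw [← measureReal_eq_zero_iff, iidLaw_real_singleton, prod_eq_zero_iff] at hu
  obtain ⟨t, -, ht⟩ := hu
  rw [← measureReal_eq_zero_iff, firstCoords_real_singleton]
  refine sum_eq_zero fun y hy => h.real_singleton_eq_zero (t := Fin.castLE hm t) ?_
  have : y (Fin.castLE hm t) = u t := congrFun (mem_filter.1 hy).2 t
  rw [this]
  exact (toMeasure_absolutelyContinuous_iff R Q).1 hRQ _ ht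

theorem HasMarginals.absolutelyContinuous_of_firstCoords (h : HasMarginals μ R) {Q : PMF (Fin k)}
    {m : ℕ} (hm : m ≤ n) (hm0 : 0 < m) (hac : firstCoords hm μ ≪ iidLaw Q m) :
    R.toMeasure ≪ Q.toMeasure := by
  have := isProbabilityMeasure_firstCoords hm μ
  rw [toMeasure_absolutelyContinuous_iff]
  intro j hj
  set t : Fin m := ⟨0, hm0⟩
  rw [← h (Fin.castLE hm t) j]
  refine sum_eq_zero fun y hy => ?_
  set u : Fin m → Fin k := fun t => y (Fin.castLE hm t) with hu
  have hz : iidLaw Q m {u} = 0 := by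
    rw [← measureReal_eq_zero_iff, iidLaw_real_singleton]
    refine prod_eq_zero (mem_univ t) ?_
    rw [show u t = j from (mem_filter.1 hy).2, hj]
  have hz' := hac hz
  rw [← measureReal_eq_zero_iff, firstCoords_real_singleton, marginal,
    sum_eq_zero_iff_of_nonneg fun _ _ => measureReal_nonneg] at hz'
  exact hz' y (by simp [hu])

/-- The divergence of an initial segment from a product law, in terms of entropies. -/
theorem HasMarginals.klDiv_firstCoords (h : HasMarginals μ R) {Q : PMF (Fin k)}
    (hRQ : R.toMeasure ≪ Q.toMeasure) {m : ℕ} (hm : m ≤ n) :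
    klDiv (firstCoords hm μ) (iidLaw Q m) = ENNReal.ofReal
        (negEntropy (marginal hm fun y => μ.real {y}) - m * crossTerm R Q) ∧
      0 ≤ negEntropy (marginal hm fun y => μ.real {y}) - m * crossTerm R Q := by
  have := isProbabilityMeasure_firstCoords hm μ
  have hac := h.firstCoords_absolutelyContinuous hRQ hm
  have he : negEntropy (marginal hm fun y => μ.real {y}) - m * crossTerm R Q =
      ∑ x, (firstCoords hm μ).real {x} *
        (Real.log ((firstCoords hm μ).real {x}) - Real.log ((iidLaw Q m).real {x})) := by
    have hlog : ∀ u : Fin m → Fin k, (firstCoords hm μ).real {u} *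
        Real.log ((iidLaw Q m).real {u}) =
        ∑ t, (firstCoords hm μ).real {u} * Real.log (Q (u t)).toReal := by
      intro u
      rcases eq_or_ne ((firstCoords hm μ).real {u}) 0 with h0 | h0
      · simp [h0]
      have hne : (iidLaw Q m).real {u} ≠ 0 := fun hz => h0 (by
        rw [measureReal_eq_zero_iff] at hz ⊢; exact hac hz)
      rw [iidLaw_real_singleton] at hne ⊢
      rw [Real.log_prod (prod_ne_zero_iff.1 hne), mul_sum]
    simp only [mul_sub, sum_sub_distrib, hlog]
    congr 1
    · simp only [negEntropy, firstCoords_real_singleton]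
    · rw [sum_comm]
      simp only [firstCoords_real_singleton]
      have ht : ∀ t : Fin m, ∑ u, marginal hm (fun y => μ.real {y}) u * Real.log (Q (u t)).toReal =
          crossTerm R Q := fun t => by
        rw [sum_marginal_mul hm _ (fun u => Real.log (Q (u t)).toReal)]
        exact h.sum_coord (Fin.castLE hm t) (fun j => Real.log (Q j).toReal)
      simp [ht]
  rw [he]
  exact ⟨klDiv_eq_sum hac, sum_mul_log_sub_log_nonneg hac⟩

/-- A vector with marginals `R` whose mass function is at most `C` times that of the product of
its marginals has a divergence from a product law within `log C` of that of the latter. -/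
theorem HasMarginals.klDiv_bounds (h : HasMarginals μ R) (hn : 0 < n) {C : ℝ} (hC : 1 ≤ C)
    (hμ : ∀ y, μ.real {y} ≤ C * ∏ t, (R (y t)).toReal) (Q : PMF (Fin k)) :
    (n : ℝ≥0∞) * klDiv R.toMeasure Q.toMeasure ≤ klDiv μ (iidLaw Q n) ∧
      klDiv μ (iidLaw Q n) ≤ (n : ℝ≥0∞) * klDiv R.toMeasure Q.toMeasure +
        ((Real.log C).toNNReal : ℝ≥0∞) := by
  by_cases hRQ : R.toMeasure ≪ Q.toMeasure
  swap
  · have hnac : ¬ μ ≪ iidLaw Q n := fun hac =>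
      hRQ (h.absolutelyContinuous_of_firstCoords le_rfl hn (by rwa [firstCoords_self]))
    have hn' : (n : ℝ≥0∞) ≠ 0 := by exact_mod_cast hn.ne'
    simp [klDiv_of_not_ac hRQ, klDiv_of_not_ac hnac, ENNReal.mul_top hn']
  obtain ⟨h1, h2⟩ := h.klDiv_firstCoords hRQ le_rfl
  -- With `Q = R`, `h4` is nonnegativity of the divergence from the product of the marginals; this
  -- is the whole lower bound.
  obtain ⟨h3, h4⟩ := h.klDiv_firstCoords (Q := R) Measure.AbsolutelyContinuous.rfl le_rfl
  rw [firstCoords_self] at h1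
  have hm : (marginal le_rfl fun y : Fin n → Fin k => μ.real {y}) = fun y => μ.real {y} :=
    funext (marginal_self _)
  rw [hm] at h1 h2 h4
  obtain ⟨h5, h6⟩ := klDiv_toMeasure hRQ
  rw [h1, h5, ← ENNReal.ofReal_natCast, ← ENNReal.ofReal_mul (by positivity)]
  refine ⟨ENNReal.ofReal_le_ofReal (by nlinarith), ?_⟩
  change _ ≤ _ + ENNReal.ofReal (Real.log C)
  rw [← ENNReal.ofReal_add (by positivity) (Real.log_nonneg hC)]
  refine ENNReal.ofReal_le_ofReal ?_
  have key : negEntropy (fun y => μ.real {y}) ≤ Real.log C + n * crossTerm R R := by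
    have hle : ∀ y, μ.real {y} * Real.log (μ.real {y}) ≤
        μ.real {y} * Real.log C + ∑ t, μ.real {y} * Real.log (R (y t)).toReal := by
      intro y
      rcases (measureReal_nonneg (μ := μ) (s := {y})).eq_or_lt with h0 | h0
      · simp [← h0]
      have hne : ∀ t ∈ univ, (R (y t)).toReal ≠ 0 := fun t _ hz =>
        h0.ne' (h.real_singleton_eq_zero hz)
      rw [← mul_sum, ← mul_add, ← Real.log_prod hne,
        ← Real.log_mul (by positivity) (prod_ne_zero_iff.2 hne)]
      exact mul_le_mul_of_nonneg_left (Real.log_le_log h0 (hμ y)) h0.le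
    have hs := sum_le_sum fun y (_ : y ∈ univ) => hle y
    rw [sum_add_distrib, ← sum_mul, sum_comm] at hs
    have ht : ∀ t : Fin n, ∑ y, μ.real {y} * Real.log (R (y t)).toReal = crossTerm R R := fun t =>
      h.sum_coord t (fun j => Real.log (R j).toReal)
    have h1 : ∑ y, μ.real {y} = 1 := by
      rw [sum_measureReal_singleton, coe_univ, probReal_univ]
    simpa [ht, h1, negEntropy] using hs
  linarith

/-- Han's inequality for the divergence of an exchangeable vector from a product law. -/
theorem HasMarginals.klDiv_firstCoords_le (h : HasMarginals μ R) (hn : 0 < n)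
    (hsymm : ∀ (σ : Equiv.Perm (Fin n)) y, μ.real {y ∘ σ} = μ.real {y}) {c : ℝ≥0}
    (hc : klDiv μ (iidLaw R n) ≤ c) (Q : PMF (Fin k)) {m : ℕ} (hm : m ≤ n) :
    klDiv (firstCoords hm μ) (iidLaw Q m) ≤ (m : ℝ≥0∞) * klDiv R.toMeasure Q.toMeasure +
      ((m : ℝ≥0∞) / (n : ℝ≥0∞)) * (c : ℝ≥0∞) := by
  -- For `m = 0` the right side is `0` even when `D(R‖Q) = ∞`, so the left side must vanish.
  rcases Nat.eq_zero_or_pos m with rfl | hm0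
  · have := isProbabilityMeasure_firstCoords hm μ
    have he : firstCoords hm μ = iidLaw Q 0 := by
      refine Measure.ext fun s _ => ?_
      rcases s.eq_empty_or_nonempty with rfl | hs
      · simp
      · simp [Subsingleton.eq_univ_of_nonempty hs]
    simp [he]
  by_cases hRQ : R.toMeasure ≪ Q.toMeasure
  swap
  · have hm' : (m : ℝ≥0∞) ≠ 0 := by exact_mod_cast hm0.ne'
    simp [klDiv_of_not_ac hRQ, ENNReal.mul_top hm']
  obtain ⟨h1, h2⟩ := h.klDiv_firstCoords hRQ hm
  obtain ⟨h3, h4⟩ := h.klDiv_firstCoords (Q := R) Measure.AbsolutelyContinuous.rfl le_rfl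
  obtain ⟨h5, h6⟩ := klDiv_toMeasure hRQ
  have hmarg : (marginal le_rfl fun y : Fin n → Fin k => μ.real {y}) = fun y => μ.real {y} :=
    funext (marginal_self _)
  rw [firstCoords_self, hmarg] at h3
  rw [h3] at hc
  have hc' : negEntropy (fun y => μ.real {y}) - n * crossTerm R R ≤ c :=
    ENNReal.ofReal_le_coe.1 hc
  have hn0 : (0 : ℝ) < n := by exact_mod_cast hn
  have hfrac : ((m : ℝ≥0∞) / (n : ℝ≥0∞)) * (c : ℝ≥0∞) = ENNReal.ofReal (m / n * c) := by
    rw [ENNReal.ofReal_mul (by positivity), ENNReal.ofReal_div_of_pos hn0,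
      ENNReal.ofReal_natCast, ENNReal.ofReal_natCast, ENNReal.ofReal_coe_nnreal]
  rw [h1, h5, hfrac, ← ENNReal.ofReal_natCast, ← ENNReal.ofReal_mul (by positivity),
    ← ENNReal.ofReal_add (by positivity) (by positivity)]
  refine ENNReal.ofReal_le_ofReal ?_
  have h1' : ∑ y, μ.real {y} = 1 := by
    rw [sum_measureReal_singleton, coe_univ, probReal_univ]
  have han := mul_negEntropy_marginal_le (f := fun y : Fin n → Fin k => μ.real {y})
    (fun _ => measureReal_nonneg) h1' hsymm hm
  have hgoal : negEntropy (marginal hm fun y => μ.real {y}) ≤ m / n * c + m * crossTerm R R := by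
    refine le_of_mul_le_mul_left (han.trans ?_) hn0
    have : (n : ℝ) * (m / n * c + m * crossTerm R R) = m * (c + n * crossTerm R R) := by
      field_simp
    rw [this]
    gcongr
    linarith
  linarith

end Product

/-! ### Type classes and count vectors. -/

section TypeClass

open Finset

theorem countVec_apply {α ι : Type*} [DecidableEq α] [Fintype ι] (x : ι → α) (a : α) :
    countVec x a = #{t | x t = a} := by
  rw [countVec, Finsupp.finsetSum_apply, card_filter]
  exact sum_congr rfl fun t _ => by rw [Finsupp.single_apply]

theorem countVec_comp_perm {α ι : Type*} [Fintype ι] (x : ι → α) (σ : Equiv.Perm ι) :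
    countVec (x ∘ σ) = countVec x :=
  Equiv.sum_comp σ (fun t => Finsupp.single (x t) 1)

theorem prod_comp_eq_prod_pow_countVec {α ι : Type*} [Fintype α] [DecidableEq α] [Fintype ι]
    (p : α → ℝ) (x : ι → α) : ∏ t, p (x t) = ∏ a, p a ^ countVec x a := by
  rw [← prod_fiberwise univ x]
  refine prod_congr rfl fun a _ => ?_
  rw [countVec_apply, ← prod_const]
  exact prod_congr rfl fun t ht => by rw [(mem_filter.1 ht).2]

theorem sum_comp_eq_sum_countVec_mul {α ι : Type*} [Fintype α] [DecidableEq α] [Fintype ι]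
    (g : α → ℝ) (x : ι → α) : ∑ t, g (x t) = ∑ a, countVec x a * g a := by
  rw [← sum_fiberwise univ x]
  refine sum_congr rfl fun a _ => ?_
  rw [countVec_apply, ← nsmul_eq_mul, ← sum_const]
  exact sum_congr rfl fun t ht => by rw [(mem_filter.1 ht).2]

variable {q k n : ℕ} {P : PMF (Fin q)} {d : Fin q →₀ ℕ}

theorem IsNType.exists_countVec (hP : IsNType n P) :
    ∃ d : Fin q →₀ ℕ, ∀ a, P a = (d a : ℝ≥0∞) / (n : ℝ≥0∞) := by
  choose j hj using hP
  exact ⟨Finsupp.equivFunOnFinite.symm j, hj⟩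

theorem toReal_eq_of_countVec (hd : ∀ a, P a = (d a : ℝ≥0∞) / (n : ℝ≥0∞)) (hn : 0 < n)
    (a : Fin q) : (d a : ℝ) = n * (P a).toReal := by
  have : (0 : ℝ) < n := by exact_mod_cast hn
  rw [hd a, ENNReal.toReal_div, ENNReal.toReal_natCast, ENNReal.toReal_natCast]
  field_simp

theorem sum_pmf_toReal {k : ℕ} (R : PMF (Fin k)) : ∑ a, (R a).toReal = 1 := by
  rw [← ENNReal.toReal_sum fun a _ => R.apply_ne_top a, ← tsum_fintype (L := .unconditional _), R.tsum_coe,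
    ENNReal.toReal_one]

theorem sum_countVec_eq (hd : ∀ a, P a = (d a : ℝ≥0∞) / (n : ℝ≥0∞)) (hn : 0 < n) :
    ∑ a, d a = n := by
  have h : (∑ a, d a : ℝ) = n := by
    simp only [toReal_eq_of_countVec hd hn]
    rw [← mul_sum, sum_pmf_toReal, mul_one]
  exact_mod_cast h

/-- The sequences of length `n` with count vector `d`. -/
noncomputable def typeFinset (n : ℕ) (d : Fin q →₀ ℕ) : Finset (Fin n → Fin q) :=
  {x | countVec x = d}

theorem typeClass_eq_coe_typeFinset (hd : ∀ a, P a = (d a : ℝ≥0∞) / (n : ℝ≥0∞)) (hn : 0 < n) :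
    typeClass n P = (typeFinset n d : Set (Fin n → Fin q)) := by
  ext x
  simp only [typeClass, typeFinset, coe_filter, mem_univ, true_and, Set.mem_ofPred_eq,
    DFunLike.ext_iff, countVec_apply]
  refine forall_congr' fun a => ?_
  have hn0 : (n : ℝ≥0∞) ≠ 0 := by exact_mod_cast hn.ne'
  rw [hd a, ENNReal.div_eq_div_iff hn0 (ENNReal.natCast_ne_top n) hn0 (ENNReal.natCast_ne_top n)]
  norm_cast
  exact Nat.mul_right_inj hn.ne'

theorem card_typeFinset_mul (hd : ∑ a, d a = n) (p : Fin q → ℝ) :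
    #(typeFinset n d) * ∏ a, p a ^ d a = multinomialMass p d := by
  rw [← sum_prod_eq_multinomialMass p hd, ← nsmul_eq_mul, ← sum_const]
  refine sum_congr rfl fun x hx => ?_
  rw [prod_comp_eq_prod_pow_countVec, (mem_filter.1 hx).2]

theorem multinomialMass_pos (hd : ∀ a, P a = (d a : ℝ≥0∞) / (n : ℝ≥0∞)) (hn : 0 < n) :
    0 < multinomialMass (fun a => (P a).toReal) d := by
  refine mul_pos (by positivity) (prod_pos fun a _ => ?_)
  rcases Nat.eq_zero_or_pos (d a) with h | h
  · simp [h]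
  · have h1 := toReal_eq_of_countVec hd hn a
    have h2 : (0 : ℝ) < n * (P a).toReal := by rw [← h1]; exact_mod_cast h
    have : 0 < (P a).toReal := pos_of_mul_pos_right h2 (by positivity)
    positivity

theorem card_typeFinset_pos (hd : ∀ a, P a = (d a : ℝ≥0∞) / (n : ℝ≥0∞)) (hn : 0 < n) :
    0 < #(typeFinset n d) := by
  have h := card_typeFinset_mul (sum_countVec_eq hd hn) (fun a => (P a).toReal)
  rw [Nat.pos_iff_ne_zero]
  intro h0
  rw [h0, Nat.cast_zero, zero_mul] at h
  exact (multinomialMass_pos hd hn).ne h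

theorem sum_typeFinset_comp_perm (σ : Equiv.Perm (Fin n)) (G : (Fin n → Fin q) → ℝ) :
    ∑ x ∈ typeFinset n d, G (x ∘ σ) = ∑ x ∈ typeFinset n d, G x := by
  refine sum_equiv (σ.symm.arrowCongr (Equiv.refl _)) (fun x => ?_) fun x _ => ?_
  · have : (σ.symm.arrowCongr (Equiv.refl (Fin q))) x = x ∘ σ := rfl
    simp [typeFinset, this, countVec_comp_perm]
  · rfl

/-- The sum over the class does not depend on the coordinate, so it can be averaged over all
coordinates, where only the count vector matters. -/
theorem sum_typeFinset_coord (t : Fin n) (g : Fin q → ℝ) :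
    n * ∑ x ∈ typeFinset n d, g (x t) = #(typeFinset n d) * ∑ a, d a * g a := by
  have h1 : ∀ s, ∑ x ∈ typeFinset n d, g (x s) = ∑ x ∈ typeFinset n d, g (x t) := fun s => by
    rw [← sum_typeFinset_comp_perm (Equiv.swap s t) (fun x => g (x s))]
    simp
  have h2 : ∑ s, ∑ x ∈ typeFinset n d, g (x s) = n * ∑ x ∈ typeFinset n d, g (x t) := by
    simp [h1]
  rw [← h2, sum_comm, ← nsmul_eq_mul, ← sum_const]
  refine sum_congr rfl fun x hx => ?_
  rw [sum_comp_eq_sum_countVec_mul, (mem_filter.1 hx).2]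

end TypeClass

/-! ### The output law: marginals, symmetry, domination. -/

section OutputLaw

open Finset

variable {q k n : ℕ} {W : Fin q → PMF (Fin k)} {P : PMF (Fin q)} {d : Fin q →₀ ℕ}

instance (x : Fin n → Fin q) : IsProbabilityMeasure (channelPow W n x) := by
  unfold channelPow; infer_instance

theorem channelPow_real_singleton (x : Fin n → Fin q) (y : Fin n → Fin k) :
    (channelPow W n x).real {y} = ∏ t, (W (x t) (y t)).toReal := by
  rw [measureReal_def, channelPow, Measure.pi_singleton, ENNReal.toReal_prod]
  refine prod_congr rfl fun t _ => ?_
  rw [PMF.toMeasure_apply_singleton _ _ (measurableSet_singleton _)]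

theorem isProbabilityMeasure_outputLaw (hd : ∀ a, P a = (d a : ℝ≥0∞) / (n : ℝ≥0∞)) (hn : 0 < n) :
    IsProbabilityMeasure (outputLaw W n P) := by
  have : IsProbabilityMeasure (uniformOn (typeClass n P)) := by
    refine isProbabilityMeasure_uniformOn (Set.toFinite _) ?_
    rw [typeClass_eq_coe_typeFinset hd hn, coe_nonempty]
    exact card_pos.1 (card_typeFinset_pos hd hn)
  exact isProbabilityMeasure_bind (measurable_of_finite _).aemeasurable
    (Filter.Eventually.of_forall fun x => inferInstance)

theorem outputLaw_real_singleton (hd : ∀ a, P a = (d a : ℝ≥0∞) / (n : ℝ≥0∞)) (hn : 0 < n)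
    (y : Fin n → Fin k) : (outputLaw W n P).real {y} =
      (#(typeFinset n d) : ℝ)⁻¹ * ∑ x ∈ typeFinset n d, ∏ t, (W (x t) (y t)).toReal := by
  rw [measureReal_def, outputLaw, Measure.bind_apply (measurableSet_singleton _)
    (measurable_of_finite _).aemeasurable, lintegral_fintype, typeClass_eq_coe_typeFinset hd hn,
    ENNReal.toReal_sum fun x _ => ENNReal.mul_ne_top (measure_ne_top _ _) ?_]
  swap
  · exact ((measure_mono (Set.subset_univ _)).trans_lt
      (by rw [uniformOn]; exact (measure_lt_top _ _))).ne
  rw [mul_sum, ← sum_subset (subset_univ (typeFinset n d))]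
  · refine sum_congr rfl fun x hx => ?_
    rw [← coe_singleton x, uniformOn_apply_finset, inter_singleton_of_mem hx, card_singleton,
      ENNReal.toReal_mul, ← channelPow_real_singleton, mul_comm, measureReal_def]
    simp
  · intro x _ hx
    rw [← coe_singleton x, uniformOn_apply_finset, inter_singleton_of_notMem hx]
    simp

theorem outputLaw_real_comp_perm (hd : ∀ a, P a = (d a : ℝ≥0∞) / (n : ℝ≥0∞)) (hn : 0 < n)
    (σ : Equiv.Perm (Fin n)) (y : Fin n → Fin k) :
    (outputLaw W n P).real {y ∘ σ} = (outputLaw W n P).real {y} := by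
  rw [outputLaw_real_singleton hd hn, outputLaw_real_singleton hd hn,
    ← sum_typeFinset_comp_perm σ]
  congr 1
  refine sum_congr rfl fun x _ => ?_
  exact Equiv.prod_comp σ (fun t => (W (x t) (y t)).toReal)

theorem bind_toReal (W : Fin q → PMF (Fin k)) (P : PMF (Fin q)) (j : Fin k) :
    (P.bind W j).toReal = ∑ a, (P a).toReal * (W a j).toReal := by
  rw [PMF.bind_apply, tsum_fintype, ENNReal.toReal_sum fun a _ =>
    ENNReal.mul_ne_top (P.apply_ne_top a) ((W a).apply_ne_top j)]
  simp only [ENNReal.toReal_mul]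

theorem sum_prod_of_coord_eq {ι β : Type*} [Fintype ι] [DecidableEq ι] [Fintype β] [DecidableEq β]
    (w : ι → β → ℝ) (hw : ∀ t, ∑ b, w t b = 1) (t : ι) (j : β) :
    ∑ y : ι → β with y t = j, ∏ s, w s (y s) = w t j := by
  have h : (univ.filter fun y : ι → β => y t = j) =
      Fintype.piFinset fun s => if s = t then {j} else univ := by
    ext y
    simp only [mem_filter, mem_univ, true_and, Fintype.mem_piFinset]
    refine ⟨fun h s => ?_, fun h => by simpa using h t⟩
    split_ifs with hs
    · simp [hs, h]
    · simp
  rw [h, ← prod_univ_sum, prod_eq_single t]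
  · simp
  · intro s _ hs
    simp [hs, hw]
  · simp

theorem hasMarginals_outputLaw (hd : ∀ a, P a = (d a : ℝ≥0∞) / (n : ℝ≥0∞)) (hn : 0 < n) :
    HasMarginals (outputLaw W n P) (P.bind W) := by
  intro t j
  simp only [outputLaw_real_singleton hd hn]
  rw [← mul_sum, sum_comm]
  have h1 : ∀ x ∈ typeFinset n d, ∑ y : Fin n → Fin k with y t = j, ∏ s, (W (x s) (y s)).toReal =
      (W (x t) j).toReal := fun x _ =>
    sum_prod_of_coord_eq (fun s b => (W (x s) b).toReal) (fun s => sum_pmf_toReal _) t j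
  rw [sum_congr rfl h1, bind_toReal]
  have h2 := sum_typeFinset_coord (d := d) t (fun a => (W a j).toReal)
  simp only [toReal_eq_of_countVec hd hn, mul_assoc] at h2
  rw [← mul_sum] at h2
  have hc : (0 : ℝ) < #(typeFinset n d) := by exact_mod_cast card_typeFinset_pos hd hn
  have hn0 : (0 : ℝ) < n := by exact_mod_cast hn
  rw [inv_mul_eq_iff_eq_mul₀ hc.ne']
  refine mul_left_cancel₀ hn0.ne' (h2.trans ?_)
  ring

theorem StrictlyPositive.exists_le (hW : StrictlyPositive W) :
    ∃ ρ : ℝ, 0 < ρ ∧ ρ ≤ 1 ∧ ∀ i j, ρ ≤ (W i j).toReal := by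
  have hpos : ∀ i j, 0 < (W i j).toReal := fun i j =>
    ENNReal.toReal_pos (hW i j).ne' ((W i).apply_ne_top j)
  rcases isEmpty_or_nonempty (Fin q × Fin k) with h | h
  · exact ⟨1, one_pos, le_rfl, fun i j => (h.false (i, j)).elim⟩
  · obtain ⟨⟨i, j⟩, hij⟩ := Finite.exists_min fun z : Fin q × Fin k => (W z.1 z.2).toReal
    refine ⟨(W i j).toReal, hpos i j, ?_, fun i' j' => hij (i', j')⟩
    exact ENNReal.toReal_le_of_le_ofReal zero_le_one (by simpa using (W i).coe_le_one j)

/-- The output law is dominated by a multiple, not depending on the length and on the type, of the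
product of its marginals. -/
theorem StrictlyPositive.exists_outputLaw_le (hW : StrictlyPositive W) :
    ∃ C : ℝ, 1 ≤ C ∧ ∀ n, 0 < n → ∀ P : PMF (Fin q), IsNType n P → ∀ y,
      (outputLaw W n P).real {y} ≤ C * ∏ t, (P.bind W (y t)).toReal := by
  obtain ⟨ρ, h0, h1, hρ⟩ := hW.exists_le
  obtain ⟨C, -, hC⟩ := exists_sum_prod_le (Fin q) h0 h1
  -- The maximum with `1` makes `log C` nonnegative.
  refine ⟨max C 1, le_max_right _ _, fun n hn P hP y => ?_⟩
  obtain ⟨d, hd⟩ := hP.exists_countVec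
  have hdn := sum_countVec_eq hd hn
  -- Unnormalised posteriors of `X_t` given `y t`, of total mass `P_Y (y t)`; they dominate `ρ`
  -- times the prior because `P_Y (y t) ≤ 1`.
  have hle := hC n (fun a => (P a).toReal) d (fun t a => (P a).toReal * (W a (y t)).toReal)
    (fun t => (P.bind W (y t)).toReal) hn (fun a => ENNReal.toReal_nonneg) (sum_pmf_toReal P) hdn
    (toReal_eq_of_countVec hd hn) (fun t => ENNReal.toReal_nonneg)
    (fun t => (bind_toReal W P (y t)).symm) fun t a => by
      have hb : (P.bind W (y t)).toReal ≤ 1 :=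
        ENNReal.toReal_le_of_le_ofReal zero_le_one (by simpa using (P.bind W).coe_le_one (y t))
      have hp : 0 ≤ (P a).toReal := ENNReal.toReal_nonneg
      calc ρ * (P.bind W (y t)).toReal * (P a).toReal ≤ (W a (y t)).toReal * 1 * (P a).toReal := by
            gcongr
            exact hρ a _
        _ = _ := by ring
  have hT := card_typeFinset_mul hdn (fun a => (P a).toReal)
  have hm := multinomialMass_pos hd hn
  have hc : (0 : ℝ) < #(typeFinset n d) := by exact_mod_cast card_typeFinset_pos hd hn
  have hπ : 0 < ∏ a, (P a).toReal ^ d a := by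
    rw [← hT] at hm
    exact pos_of_mul_pos_right hm hc.le
  have hsum : ∑ x : Fin n → Fin q with countVec x = d,
      ∏ t, ((P (x t)).toReal * (W (x t) (y t)).toReal) =
      (∏ a, (P a).toReal ^ d a) * ∑ x ∈ typeFinset n d, ∏ t, (W (x t) (y t)).toReal := by
    rw [mul_sum]
    refine sum_congr rfl fun x hx => ?_
    rw [prod_mul_distrib, prod_comp_eq_prod_pow_countVec (fun a => (P a).toReal),
      (mem_filter.1 hx).2]
  rw [hsum, ← hT] at hle
  rw [outputLaw_real_singleton hd hn, inv_mul_le_iff₀ hc]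
  have hprod : 0 ≤ ∏ t, (P.bind W (y t)).toReal := prod_nonneg fun t _ => ENNReal.toReal_nonneg
  refine le_of_mul_le_mul_left (hle.trans ?_) hπ
  calc C * (#(typeFinset n d) * ∏ a, (P a).toReal ^ d a) * ∏ t, (P.bind W (y t)).toReal
      ≤ max C 1 * (#(typeFinset n d) * ∏ a, (P a).toReal ^ d a) *
        ∏ t, (P.bind W (y t)).toReal := by
        gcongr
        exact le_max_left _ _
    _ = _ := by ring

end OutputLaw

end NoisyPermutation

/-! ### Main theorem. -/

theorem mainTheorem7 (q k : ℕ) (W : Fin q → PMF (Fin k))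
    (hW : NoisyPermutation.StrictlyPositive W) :
    (∃ c : ℝ≥0, NoisyPermutation.IsTypeConstant W c) ∧
    ∀ c : ℝ≥0, NoisyPermutation.IsTypeConstant W c →
      ∀ n : ℕ, 0 < n → ∀ P : PMF (Fin q), NoisyPermutation.IsNType n P →
        ∀ Q : PMF (Fin k), ∀ (m : ℕ) (hm : m ≤ n),
          klDiv (NoisyPermutation.firstCoords hm (NoisyPermutation.outputLaw W n P))
              (NoisyPermutation.iidLaw Q m) ≤
            (m : ℝ≥0∞) * klDiv (NoisyPermutation.outputMarginal W P) Q.toMeasure +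
              ((m : ℝ≥0∞) / (n : ℝ≥0∞)) * (c : ℝ≥0∞) := by
  constructor
  · obtain ⟨C, hC1, hC⟩ := hW.exists_outputLaw_le
    refine ⟨(Real.log C).toNNReal, fun n hn P hP Q => ?_⟩
    obtain ⟨d, hd⟩ := hP.exists_countVec
    have := NoisyPermutation.isProbabilityMeasure_outputLaw (W := W) hd hn
    exact (NoisyPermutation.hasMarginals_outputLaw hd hn).klDiv_bounds hn hC1 (hC n hn P hP) Q
  · intro c hc n hn P hP Q m hm
    obtain ⟨d, hd⟩ := hP.exists_countVec
    have := NoisyPermutation.isProbabilityMeasure_outputLaw (W := W) hd hn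
    refine (NoisyPermutation.hasMarginals_outputLaw hd hn).klDiv_firstCoords_le hn
      (NoisyPermutation.outputLaw_real_comp_perm hd hn) ?_ Q hm
    -- At `Q_Y = P_Y` the single-letter divergence vanishes, so `c` bounds the divergence from
    -- `P_Y^n`.
    have h := (hc n hn P hP (P.bind W)).2
    rwa [NoisyPermutation.outputMarginal, klDiv_self, mul_zero, zero_add] at h
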